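/- Let $E$ be a Dedekind complete real vector lattice and let $T$ be an orthomorphism of $E$, that is, an order bounded linear operator $T:E\to E$ with $T(B)\subseteq B$ for every band $B$ of $E$. Let $(x_\alpha)$ be a net in $E$. (1) Suppose that $E$ admits a Hausdorff uo-Lebesgue topology $\widehat\tau_E$, that is, a Hausdorff locally solid linear topology such that every net that is unbounded order convergent to $0$ in $E$ converges to $0$ in $\widehat\tau_E$. If $x_\alpha\to 0$ in $\widehat\tau_E$, then $Tx_\alpha\to 0$ in $\widehat\tau_E$. (2) Let $\tau_E$ be a (not necessarily Hausdorff) locally solid linear topology on $E$, and let $\mathrm{u}_E\tau_E$ be the unbounded topology generated by it, that is, the unique locally solid linear topology on $E$ such that a net $(y_\beta)$ in $E$ satisfies $y_\beta\to 0$ in $\mathrm{u}_E\tau_E$ if and only if $|y_\beta|\wedge|s|\to 0$ in $\tau_E$ for all $s\in E$. If $x_\alpha\to 0$ in $\tau_E$, then $Tx_\alpha\to 0$ in $\mathrm{u}_E\tau_E$. Here a net $(y_\beta)_{\beta}$ in $E$ is unbounded order convergent to $0$ if for every $y\in E$ with $y\ge 0$ there is a net $(z_\gamma)_\gamma$ in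 $E$ with $z_\gamma\downarrow 0$ such that for every $\gamma_0$ there exists $\beta_0$ with $|y_\beta|\wedge y\le z_{\gamma_0}$ for all $\beta\ge\beta_0$. -/

import Mathlib

open Filter Set

universe u v

/-- A set which is a band of the vector lattice `E`: a solid linear subspace (an ideal) that
contains every supremum, existing in `E`, of a subset of it. -/
structure IsBand {E : Type u} [AddCommGroup E] [Lattice E] [Module ℝ E]
    (B : Submodule ℝ E) : Prop where
  solid : LatticeOrderedAddCommGroup.IsSolid (B : Set E)
  sup_mem : ∀ (D : Set E) (x : E), D ⊆ B → IsLUB D x → x ∈ B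

/-- `T` maps order bounded sets to order bounded sets. -/
def IsOrderBoundedOperator {E : Type u} [AddCommGroup E] [Lattice E] [Module ℝ E]
    (T : E →ₗ[ℝ] E) : Prop :=
  ∀ s : Set E, BddBelow s → BddAbove s → BddBelow (T '' s) ∧ BddAbove (T '' s)

/-- An orthomorphism of `E`: an order bounded operator that preserves every band. -/
structure IsOrthomorphism {E : Type u} [AddCommGroup E] [Lattice E] [Module ℝ E]
    (T : E →ₗ[ℝ] E) : Prop where
  orderBounded : IsOrderBoundedOperator T
  bandPreserving : ∀ B : Submodule ℝ E, IsBand B → ∀ x ∈ B, T x ∈ B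

/-- Order convergence of the net `x` to `a`: for some net `y` with `y ↓ 0`, indexed by a directed
set that need not be that of `x`, each `y b` eventually dominates `|a - x i|`. (Since the range of
`y`, reversed, can serve as index set, one universe of index sets `B` is enough.) -/
def OrderConverges {E : Type u} [AddCommGroup E] [Lattice E] {ι : Type v} [Preorder ι]
    (x : ι → E) (a : E) : Prop :=
  ∃ (B : Type u) (_ : Preorder B) (_ : IsDirectedOrder B) (_ : Nonempty B) (y : B → E),
    Antitone y ∧ IsGLB (range y) 0 ∧ ∀ b : B, ∃ i₀ : ι, ∀ i ≥ i₀, |a - x i| ≤ y b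

/-- Unbounded order convergence of the net `x` to `a`. -/
def UnboundedOrderConverges {E : Type u} [AddCommGroup E] [Lattice E] {ι : Type v} [Preorder ι]
    (x : ι → E) (a : E) : Prop :=
  ∀ y : E, 0 ≤ y → OrderConverges (fun i => |x i - a| ⊓ y) 0

/-- A (not necessarily Hausdorff) locally solid linear topology on `E`. -/
structure IsLocallySolidLinearTopology {E : Type u} [AddCommGroup E] [Lattice E] [Module ℝ E]
    (τ : TopologicalSpace E) : Prop where
  topologicalAddGroup : @IsTopologicalAddGroup E τ _
  continuousSMul : @ContinuousSMul ℝ E _ _ τ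
  exists_solid : ∀ U ∈ @nhds E τ 0, ∃ V ∈ @nhds E τ 0,
    LatticeOrderedAddCommGroup.IsSolid V ∧ V ⊆ U

/-- A (not necessarily Hausdorff) uo-Lebesgue topology on `E`: a locally solid linear topology
for which uo-null nets are null nets. (A net with a larger index set has the same tails as a net
indexed by pairs of a tail set and a point of it, so one universe is enough.) -/
structure IsUoLebesgueTopology {E : Type u} [AddCommGroup E] [Lattice E] [Module ℝ E]
    (τ : TopologicalSpace E) : Prop where
  locallySolid : IsLocallySolidLinearTopology τ
  tendsto_of_uo : ∀ (ι : Type u) [Preorder ι] [IsDirectedOrder ι] [Nonempty ι] (x : ι → E),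
    UnboundedOrderConverges x 0 → Tendsto x atTop (@nhds E τ 0)

/-- The filter of neighbourhoods of `a` in the unbounded topology: it is generated by the sets
`{x | |x - a| ⊓ |s| ∈ V}`, for `s` in `E` and `V` a `τ`-neighbourhood of `0`. -/
def unboundedNhds {E : Type u} [AddCommGroup E] [Lattice E] (τ : TopologicalSpace E) (a : E) :
    Filter E :=
  ⨅ s : E, comap (fun x => |x - a| ⊓ |s|) (@nhds E τ 0)

/-- The unbounded topology on `E` that is generated by `τ` (via the whole of `E`). That it is the
unique locally solid linear topology with the prescribed null nets is proved below. -/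
@[reducible] def unboundedTopology {E : Type u} [AddCommGroup E] [Lattice E] (τ : TopologicalSpace E) :
    TopologicalSpace E :=
  TopologicalSpace.mkOfNhds (unboundedNhds τ)

theorem abs_add_inf_le {E : Type u} [AddCommGroup E] [Lattice E] [IsOrderedAddMonoid E]
    (x y s : E) : |x + y| ⊓ |s| ≤ |x| ⊓ |s| + |y| ⊓ |s| := by
  have hy : 0 ≤ |y| ⊓ |s| := le_inf (abs_nonneg _) (abs_nonneg _)
  have h1 : |x + y| ⊓ |s| ≤ (|x| + |y|) ⊓ |s| := inf_le_inf_right _ (abs_add_le x y)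
  refine h1.trans (sub_le_iff_le_add.mp (le_inf ?_ ?_))
  · have h := abs_inf_sub_inf_le_abs (|x| + |y|) |y| |s|
    rw [add_sub_cancel_right, abs_abs] at h
    exact (le_abs_self _).trans h
  · exact (sub_le_self _ hy).trans inf_le_right

theorem abs_smul_le_smul_abs {E : Type u} [AddCommGroup E] [Lattice E] [Module ℝ E]
    [IsOrderedModule ℝ E] (r : ℝ) (x : E) : |r • x| ≤ |r| • |x| := by
  have key : ∀ (c : ℝ), 0 ≤ c → |c • x| ≤ c • |x| := fun c hc => by
    refine abs_le'.mpr ⟨smul_le_smul_of_nonneg_left (le_abs_self x) hc, ?_⟩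
    rw [← smul_neg]
    exact smul_le_smul_of_nonneg_left (neg_le_abs x) hc
  rcases le_total 0 r with h | h
  · rw [abs_of_nonneg h]; exact key r h
  · rw [abs_of_nonpos h, ← abs_neg (r • x), ← neg_smul]; exact key (-r) (neg_nonneg.mpr h)

theorem IsLocallySolidLinearTopology.squeeze {E : Type u} [AddCommGroup E] [Lattice E] [Module ℝ E]
    {τ : TopologicalSpace E} (hτ : IsLocallySolidLinearTopology τ)
    {ι : Type v} {l : Filter ι} {f g : ι → E} (hfg : ∀ᶠ i in l, |f i| ≤ |g i|)
    (hg : Tendsto g l (@nhds E τ 0)) : Tendsto f l (@nhds E τ 0) := by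
  intro U hU
  obtain ⟨V, hV, hVs, hVU⟩ := hτ.exists_solid U hU
  have hgV : ∀ᶠ i in l, g i ∈ V := hg hV
  show ∀ᶠ i in l, f i ∈ U
  filter_upwards [hfg, hgV] with i hi hgi
  exact hVU (hVs hgi hi)

theorem tendsto_unboundedNhds {E : Type u} [AddCommGroup E] [Lattice E] {τ : TopologicalSpace E}
    {ι : Type v} {l : Filter ι} {f : ι → E} {a : E} :
    Tendsto f l (unboundedNhds τ a) ↔
      ∀ s : E, Tendsto (fun i => |f i - a| ⊓ |s|) l (@nhds E τ 0) := by
  simp only [unboundedNhds, tendsto_iInf, tendsto_comap_iff]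
  rfl

section Unbounded

variable {E : Type u} [AddCommGroup E] [Lattice E] [IsOrderedAddMonoid E] [Module ℝ E]
  {τ : TopologicalSpace E}

theorem mem_unboundedNhds (hτ : IsLocallySolidLinearTopology τ) {a : E} {U : Set E} :
    U ∈ unboundedNhds τ a ↔ ∃ s : E, ∃ V ∈ @nhds E τ 0,
      LatticeOrderedAddCommGroup.IsSolid V ∧ {x | |x - a| ⊓ |s| ∈ V} ⊆ U := by
  have hdir : Directed (· ≥ ·) fun s : E => comap (fun x => |x - a| ⊓ |s|) (@nhds E τ 0) := by
    have aux : ∀ s t : E, |s| ≤ |t| → comap (fun x => |x - a| ⊓ |t|) (@nhds E τ 0) ≤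
        comap (fun x => |x - a| ⊓ |s|) (@nhds E τ 0) := fun s t hst => by
      refine tendsto_iff_comap.mp (hτ.squeeze (.of_forall fun x => ?_) tendsto_comap)
      rw [abs_of_nonneg (le_inf (abs_nonneg _) (abs_nonneg _)),
        abs_of_nonneg (le_inf (abs_nonneg _) (abs_nonneg _))]
      exact inf_le_inf_left _ hst
    intro s t
    have h : |(|s| ⊔ |t|)| = |s| ⊔ |t| := abs_of_nonneg ((abs_nonneg s).trans le_sup_left)
    exact ⟨|s| ⊔ |t|, aux _ _ (le_sup_left.trans h.ge), aux _ _ (le_sup_right.trans h.ge)⟩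
  rw [unboundedNhds, mem_iInf_of_directed hdir]
  refine exists_congr fun s => ⟨fun h => ?_, fun ⟨V, hV, _, hVU⟩ => ⟨V, hV, hVU⟩⟩
  obtain ⟨W, hW, hWU⟩ := h
  obtain ⟨V, hV, hVs, hVW⟩ := hτ.exists_solid W hW
  exact ⟨V, hV, hVs, fun x hx => hWU (hVW hx)⟩

theorem nhds_unboundedTopology (hτ : IsLocallySolidLinearTopology τ) (a : E) :
    @nhds E (unboundedTopology τ) a = unboundedNhds τ a := by
  have := hτ.topologicalAddGroup
  refine TopologicalSpace.nhds_mkOfNhds _ a (fun b => ?_) (fun b U hU => ?_)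
  · have hid : Tendsto id (pure b) (unboundedNhds τ b) := by
      refine tendsto_unboundedNhds.mpr fun s => ?_
      rw [tendsto_pure_left]
      intro V hV
      simpa using mem_of_mem_nhds hV
    exact hid
  · obtain ⟨s, V, hV, hVs, hVU⟩ := (mem_unboundedNhds hτ).mp hU
    have hadd : Tendsto (fun p : E × E => p.1 + p.2) (nhds 0 ×ˢ nhds 0) (nhds 0) := by
      simpa [nhds_prod_eq] using (continuous_add (M := E)).tendsto (0, 0)
    obtain ⟨W₁, hW₁, W₂, hW₂, hW⟩ := mem_prod_iff.mp (hadd hV)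
    obtain ⟨W, hWn, hWs, hWW⟩ := hτ.exists_solid _ (inter_mem hW₁ hW₂)
    refine (mem_unboundedNhds hτ).mpr ⟨s, W, hWn, hWs, fun y hy => ?_⟩
    refine (mem_unboundedNhds hτ).mpr ⟨s, W, hWn, hWs, fun x hx => hVU ?_⟩
    have h := abs_add_inf_le (x - y) (y - b) s
    rw [sub_add_sub_cancel] at h
    have hm : |x - y| ⊓ |s| + |y - b| ⊓ |s| ∈ V :=
      hW (show (|x - y| ⊓ |s|, |y - b| ⊓ |s|) ∈ W₁ ×ˢ W₂ from ⟨(hWW hx).1, (hWW hy).2⟩)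
    refine hVs hm (abs_le_abs_of_nonneg (le_inf (abs_nonneg _) (abs_nonneg _)) h)

/-- The defining property of the unbounded topology: `f → 0` if and only if
`|f| ⊓ |s| → 0` for `τ`, for all `s`. -/
theorem tendsto_unboundedTopology_zero (hτ : IsLocallySolidLinearTopology τ)
    {ι : Type v} {l : Filter ι} {f : ι → E} :
    Tendsto f l (@nhds E (unboundedTopology τ) 0) ↔
      ∀ s : E, Tendsto (fun i => |f i| ⊓ |s|) l (@nhds E τ 0) := by
  rw [nhds_unboundedTopology hτ, tendsto_unboundedNhds]
  simp

variable [IsOrderedModule ℝ E]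

theorem isLocallySolidLinearTopology_unboundedTopology (hτ : IsLocallySolidLinearTopology τ) :
    IsLocallySolidLinearTopology (unboundedTopology τ) := by
  have h0 := fun (ι : Type u) (l : Filter ι) (f : ι → E) =>
    tendsto_unboundedTopology_zero (l := l) (f := f) hτ
  have hnn : ∀ x s : E, |(|x| ⊓ |s|)| = |x| ⊓ |s| := fun x s =>
    abs_of_nonneg (le_inf (abs_nonneg _) (abs_nonneg _))
  have hid : ∀ s : E, Tendsto (fun x : E => |x| ⊓ |s|) (@nhds E (unboundedTopology τ) 0)
      (@nhds E τ 0) := (h0 E _ _).mp tendsto_id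
  have hgrp : @IsTopologicalAddGroup E (unboundedTopology τ) _ := by
    let _ := unboundedTopology τ
    refine IsTopologicalAddGroup.of_comm_of_nhds_zero (G := E) ?_ ?_ fun a => ?_
    · refine (h0 _ _ _).mpr fun s => ?_
      have hadd : Tendsto (fun p : E × E => p.1 + p.2) (@nhds E τ 0 ×ˢ @nhds E τ 0)
          (@nhds E τ 0) := by
        let _ := τ
        have := hτ.topologicalAddGroup
        simpa [nhds_prod_eq] using (continuous_add (M := E)).tendsto (0, 0)
      refine hτ.squeeze (.of_forall fun p => ?_)
        (hadd.comp (((hid s).comp tendsto_fst).prodMk ((hid s).comp tendsto_snd)))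
      exact abs_le_abs_of_nonneg (le_inf (abs_nonneg _) (abs_nonneg _))
        (abs_add_inf_le p.1 p.2 s)
    · refine (h0 _ _ _).mpr fun s => ?_
      simpa using hid s
    · refine le_antisymm ?_ ?_
      · have hm : map (fun x => a + x) (map (fun x => x - a) (nhds a)) = nhds a := by
          simp [Filter.map_map, Function.comp_def]
        rw [← hm]
        refine map_mono ?_
        refine (h0 _ _ _).mpr ?_
        rw [nhds_unboundedTopology hτ]
        exact tendsto_unboundedNhds.mp tendsto_id
      · rw [nhds_unboundedTopology hτ a]
        refine tendsto_unboundedNhds.mpr fun s => ?_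
        simpa using hid s
  refine ⟨hgrp, ?_, fun U hU => ?_⟩
  · let _ := unboundedTopology τ
    have hτs : ∀ a : ℝ, Tendsto (fun x : E => a • x) (@nhds E τ 0) (@nhds E τ 0) := fun a => by
      let _ := τ
      have := hτ.continuousSMul
      simpa using (continuous_const_smul (T := E) a).tendsto 0
    have hτm : ∀ m : E, Tendsto (fun a : ℝ => a • m) (nhds 0) (@nhds E τ 0) := fun m => by
      let _ := τ
      have := hτ.continuousSMul
      have hc : Continuous fun a : ℝ => a • m := continuous_id.smul continuous_const
      simpa using hc.tendsto 0
    refine ContinuousSMul.of_nhds_zero ?_ (fun m => ?_) (fun a => ?_)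
    · refine (tendsto_unboundedTopology_zero hτ).mpr fun s => ?_
      refine hτ.squeeze ?_ ((hid s).comp tendsto_snd)
      have hsmall : ∀ᶠ r : ℝ in nhds 0, |r| ≤ 1 := by
        filter_upwards [Metric.closedBall_mem_nhds (0 : ℝ) one_pos] with r hr
        simpa using hr
      filter_upwards [tendsto_fst.eventually hsmall] with p hp
      simp only [Function.comp, hnn]
      refine inf_le_inf_right _ ((abs_smul_le_smul_abs p.1 p.2).trans ?_)
      simpa using smul_le_smul_of_nonneg_right hp (abs_nonneg p.2)
    · refine (tendsto_unboundedTopology_zero hτ).mpr fun s => ?_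
      refine hτ.squeeze (.of_forall fun r => ?_) (hτm m)
      rw [hnn]
      exact inf_le_left
    · refine (tendsto_unboundedTopology_zero hτ).mpr fun s => ?_
      have hK : 0 < max 1 |a| := lt_max_of_lt_left one_pos
      refine hτ.squeeze (.of_forall fun x => ?_) ((hτs (max 1 |a|)).comp (hid s))
      rw [hnn]
      refine le_trans ?_ (le_abs_self _)
      rw [Function.comp, ← inv_smul_le_iff_of_pos hK]
      refine le_inf ?_ ?_
      · rw [inv_smul_le_iff_of_pos hK]
        exact inf_le_left.trans ((abs_smul_le_smul_abs a x).trans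
          (smul_le_smul_of_nonneg_right (le_max_right _ _) (abs_nonneg x)))
      · rw [inv_smul_le_iff_of_pos hK]
        refine inf_le_right.trans ?_
        simpa using smul_le_smul_of_nonneg_right (le_max_left 1 |a|) (abs_nonneg s)
  · rw [nhds_unboundedTopology hτ] at hU
    obtain ⟨s, V, hV, hVs, hVU⟩ := (mem_unboundedNhds hτ).mp hU
    refine ⟨{x | |x - 0| ⊓ |s| ∈ V}, ?_, fun x hx y hxy => ?_, hVU⟩
    · rw [nhds_unboundedTopology hτ]
      exact (mem_unboundedNhds hτ).mpr ⟨s, V, hV, hVs, Subset.rfl⟩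
    · simp only [mem_ofPred_eq, sub_zero] at hx ⊢
      refine hVs hx ?_
      rw [hnn, hnn]
      exact inf_le_inf_right _ hxy

/-- The unbounded topology is the only locally solid linear topology with its null nets. -/
theorem eq_unboundedTopology (hτ : IsLocallySolidLinearTopology τ) {σ : TopologicalSpace E}
    (hσ : IsLocallySolidLinearTopology σ)
    (h : ∀ (ι : Type u) [Preorder ι] [IsDirectedOrder ι] [Nonempty ι] (x : ι → E),
      Tendsto x atTop (@nhds E σ 0) ↔
        ∀ s : E, Tendsto (fun i => |x i| ⊓ |s|) atTop (@nhds E τ 0)) :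
    σ = unboundedTopology τ := by
  have hu := isLocallySolidLinearTopology_unboundedTopology hτ
  refine IsTopologicalAddGroup.ext hσ.topologicalAddGroup hu.topologicalAddGroup ?_
  have hnet : ∀ F G : Filter E,
      (∀ (ι : Type u) [Preorder ι] [IsDirectedOrder ι] [Nonempty ι] (x : ι → E),
        Tendsto x atTop F → Tendsto x atTop G) → F ≤ G := by
    intro F G hFG U hU
    by_contra hUF
    have hne : ∀ A : {A : Set E // A ∈ F}, ∃ x ∈ A.1, x ∉ U := fun A => by
      by_contra! hA
      exact hUF (mem_of_superset A.2 hA)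
    choose x hxA hxU using hne
    let y : {A : Set E // A ∈ F}ᵒᵈ → E := fun A => x (OrderDual.ofDual A)
    have hdir : IsDirectedOrder {A : Set E // A ∈ F}ᵒᵈ :=
      ⟨fun A B => ⟨OrderDual.toDual ⟨_, inter_mem (OrderDual.ofDual A).2 (OrderDual.ofDual B).2⟩,
        fun _ hz => hz.1, fun _ hz => hz.2⟩⟩
    have hnon : Nonempty {A : Set E // A ∈ F}ᵒᵈ := ⟨OrderDual.toDual ⟨univ, univ_mem⟩⟩
    have hy : Tendsto y atTop F := fun A hA => by
      refine mem_map.mpr (mem_atTop_sets.mpr ⟨OrderDual.toDual ⟨A, hA⟩, fun B hB => ?_⟩)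
      exact hB (hxA (OrderDual.ofDual B))
    obtain ⟨A, hA⟩ := (hFG _ y hy hU |> mem_map.mp |> mem_atTop_sets.mp)
    exact hxU _ (hA A le_rfl)
  refine le_antisymm (hnet _ _ fun ι _ _ _ x hx => ?_) (hnet _ _ fun ι _ _ _ x hx => ?_)
  · exact (tendsto_unboundedTopology_zero hτ).mpr ((h ι x).mp hx)
  · exact (h ι x).mpr ((tendsto_unboundedTopology_zero hτ).mp hx)

end Unbounded

/-!
Off the set where `|T| ≤ c`, an element `s` is at most `c⁻¹ |T s|`. This heuristic, for `T` a
multiplication operator, becomes the estimate `(|T x| - c |x|)⁺ ⊓ s ≤ c⁻¹ |T s|`, valid for every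
orthomorphism of an Archimedean vector lattice, and both continuity statements follow from
`|T x| ≤ c |x| + (|T x| - c |x|)⁺`: the second summand is uo-null as `c → ∞`, uniformly in `x`, and
its infimum with `s` is small in every linear topology.

The estimate expresses that `(|T| - c)⁺` and `(|T| - c)⁻` live on disjoint bands. It follows from
Meyer's theorem for `S = ±T - c`: if `S` is an orthomorphism and `x, s ≥ 0`, then `(S x)⁺ ⊥ (S s)⁻`.
To see this, let `w = (S x)⁺ ⊓ (S s)⁻` and follow `S (x - j ε s)⁺` as `j` grows. On the band of `w`
it is at least `w` as long as `j ε s ≤ x`, and it vanishes where `x ≤ j ε s`. As `S` is order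
bounded, each step changes it by at most `ε M`, so `w ≤ ε M` for all `ε > 0`.
-/

section Archimedean

/-- The Archimedean property of vector lattices: `w ≤ 0` as soon as its multiples are
bounded above. Mathlib's `Archimedean` is unsuitable, as it makes every positive element an order
unit. -/
class IsArchimedeanOrderedGroup (E : Type u) [AddCommGroup E] [PartialOrder E] : Prop where
  nonpos_of_forall_nsmul_le : ∀ w z : E, (∀ n : ℕ, n • w ≤ z) → w ≤ 0

instance {E : Type u} [AddCommGroup E] [ConditionallyCompleteLattice E] [IsOrderedAddMonoid E] :
    IsArchimedeanOrderedGroup E where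
  nonpos_of_forall_nsmul_le w z h := by
    have hbdd : BddAbove (range fun n : ℕ => n • w) := ⟨z, forall_mem_range.mpr h⟩
    have hsup : (⨆ n : ℕ, n • w) ≤ (⨆ n : ℕ, n • w) - w := ciSup_le fun n => by
      rw [le_sub_iff_add_le, ← succ_nsmul]
      exact le_ciSup hbdd (n + 1)
    exact (le_sub_self_iff _).mp hsup

variable {E : Type u} [AddCommGroup E] [Lattice E] [IsArchimedeanOrderedGroup E]
  [Module ℝ E] [IsOrderedModule ℝ E]

theorem nonpos_of_forall_le_inv_smul {w z : E} (h : ∀ n : ℕ, w ≤ ((n : ℝ) + 1)⁻¹ • z) : w ≤ 0 := by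
  refine IsArchimedeanOrderedGroup.nonpos_of_forall_nsmul_le w z⁺ fun n => ?_
  rcases n with _ | n
  · simp
  · have hn : (0 : ℝ) < n + 1 := n.cast_add_one_pos
    rw [← Nat.cast_smul_eq_nsmul ℝ, Nat.cast_succ]
    exact ((le_inv_smul_iff_of_pos hn).mp (h n)).trans (le_posPart z)

theorem isGLB_range_inv_smul {z : E} (hz : 0 ≤ z) :
    IsGLB (range fun n : ℕ => ((n : ℝ) + 1)⁻¹ • z) 0 :=
  ⟨forall_mem_range.mpr fun n => smul_nonneg (inv_nonneg.mpr n.cast_add_one_pos.le) hz,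
    fun _ hw => nonpos_of_forall_le_inv_smul fun n => hw (mem_range_self n)⟩

end Archimedean

section LatticeOrderedGroup

variable {E : Type u} [AddCommGroup E] [Lattice E] [IsOrderedAddMonoid E]

theorem posPart_add_le (a b : E) : (a + b)⁺ ≤ a⁺ + b⁺ :=
  sup_le (add_le_add (le_posPart a) (le_posPart b))
    (add_nonneg (posPart_nonneg a) (posPart_nonneg b))

theorem add_inf_le_add_inf {a b c : E} (ha : 0 ≤ a) : (a + b) ⊓ c ≤ a + b ⊓ c := by
  rw [add_inf]
  exact inf_le_inf_left _ (le_add_of_nonneg_left ha)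

theorem le_of_inf_posPart_sub_eq_zero {a b c : E} (hc : 0 ≤ c) (h : a ⊓ (b - c)⁺ = 0) :
    a ⊓ b ≤ c := by
  rw [← sub_nonpos, inf_sub, ← h]
  exact inf_le_inf (sub_le_self a hc) (le_posPart _)

theorem posPart_sub_posPart_sub_mem_Icc (a : E) {d : E} (hd : 0 ≤ d) :
    a⁺ - (a - d)⁺ ∈ Icc 0 d := by
  refine ⟨sub_nonneg.mpr (posPart_mono (sub_le_self a hd)), sub_le_iff_le_add'.mpr ?_⟩
  simpa [posPart_of_nonneg hd] using posPart_add_le (a - d) d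

theorem unboundedOrderConverges_zero_of_antitone {z : ℕ → E}
    (h : ∀ s : E, 0 ≤ s → ∃ y : ℕ → E, Antitone y ∧ IsGLB (range y) 0 ∧ ∀ n, |z n| ⊓ s ≤ y n) :
    UnboundedOrderConverges z 0 := fun s hs => by
  obtain ⟨y, hanti, hglb, hzy⟩ := h s hs
  refine ⟨ULift ℕ, inferInstance, ⟨fun m n => ⟨⟨m.down ⊔ n.down⟩, le_sup_left, le_sup_right⟩⟩,
    inferInstance, fun n => y n.down, fun m n hmn => hanti hmn, ?_,
    fun n => ⟨n.down, fun m hm => ?_⟩⟩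
  · rwa [← Function.comp_def, ULift.down_surjective.range_comp]
  · have hnonneg : 0 ≤ |z m| ⊓ s := le_inf (abs_nonneg _) hs
    simpa [abs_of_nonneg hnonneg] using (hzy m).trans (hanti hm)

end LatticeOrderedGroup

section DisjointComplement

variable {E : Type u} [AddCommGroup E] [Lattice E] [IsOrderedAddMonoid E] [Module ℝ E]
  [IsOrderedModule ℝ E]

/-- The elements disjoint from `v`, as a subspace. For `a b : E`, the relation
`(a - b)⁺ ∈ disjointComplement v` means that `a ≤ b` on the band generated by `v`. -/
def disjointComplement (v : E) : Submodule ℝ E where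
  carrier := {a | |a| ⊓ |v| = 0}
  zero_mem' := by simp
  add_mem' {a b} ha hb := by
    refine le_antisymm ((abs_add_inf_le a b v).trans_eq ?_)
      (le_inf (abs_nonneg _) (abs_nonneg _))
    rw [ha, hb, add_zero]
  smul_mem' c a ha := by
    have hc : 0 < max 1 |c| := lt_max_of_lt_left one_pos
    have hle : (max 1 |c|)⁻¹ • (|c • a| ⊓ |v|) ≤ |a| ⊓ |v| := by
      refine le_inf ?_ ?_ <;> rw [inv_smul_le_iff_of_pos hc]
      · exact inf_le_left.trans ((abs_smul_le_smul_abs c a).trans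
          (smul_le_smul_of_nonneg_right (le_max_right _ _) (abs_nonneg a)))
      · exact inf_le_right.trans (le_smul_of_one_le_left (abs_nonneg v) (le_max_left _ _))
    rw [ha, inv_smul_le_iff_of_pos hc, smul_zero] at hle
    exact le_antisymm hle (le_inf (abs_nonneg _) (abs_nonneg _))

theorem mem_disjointComplement {a v : E} : a ∈ disjointComplement v ↔ |a| ⊓ |v| = 0 := Iff.rfl

theorem mem_disjointComplement_comm {a v : E} :
    a ∈ disjointComplement v ↔ v ∈ disjointComplement a := by
  rw [mem_disjointComplement, mem_disjointComplement, inf_comm]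

theorem isSolid_disjointComplement (v : E) :
    LatticeOrderedAddCommGroup.IsSolid (disjointComplement v : Set E) := fun _ ha _ hba =>
  le_antisymm ((inf_le_inf_right _ hba).trans_eq ha) (le_inf (abs_nonneg _) (abs_nonneg _))

theorem mem_disjointComplement_of_le {a b v : E} (hb : 0 ≤ b) (hba : b ≤ a)
    (ha : a ∈ disjointComplement v) : b ∈ disjointComplement v :=
  isSolid_disjointComplement v ha (abs_le_abs_of_nonneg hb hba)

theorem disjointComplement_anti {v w : E} (hv : 0 ≤ v) (hvw : v ≤ w) :
    disjointComplement w ≤ disjointComplement v := fun _ ha =>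
  mem_disjointComplement_comm.mp
    (mem_disjointComplement_of_le hv hvw (mem_disjointComplement_comm.mp ha))

theorem posPart_mem_disjointComplement_negPart (a : E) : a⁺ ∈ disjointComplement a⁻ := by
  rw [mem_disjointComplement, abs_of_nonneg (posPart_nonneg a), abs_of_nonneg (negPart_nonneg a)]
  exact posPart_inf_negPart_eq_zero a

theorem eq_zero_of_mem_disjointComplement_of_le {a v : E} (ha : 0 ≤ a) (hav : a ≤ v)
    (h : a ∈ disjointComplement v) : a = 0 := by
  rwa [mem_disjointComplement, abs_of_nonneg ha, abs_of_nonneg (ha.trans hav),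
    inf_eq_left.mpr hav] at h

theorem posPart_mem_disjointComplement_of_isLUB {v x : E} {D : Set E}
    (hD : D ⊆ disjointComplement v) (hx : IsLUB D x) : x⁺ ∈ disjointComplement v := by
  set a := x⁺ ⊓ |v|
  have ha : 0 ≤ a := le_inf (posPart_nonneg x) (abs_nonneg v)
  have hd : ∀ d ∈ D, d ≤ x⁺ - a := fun d hd => by
    have hda : d⁺ ⊓ a = 0 := le_antisymm
      ((inf_le_inf (sup_le (le_abs_self d) (abs_nonneg d)) inf_le_right).trans_eq (hD hd))
      (le_inf (posPart_nonneg d) ha)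
    rw [le_sub_iff_add_le]
    calc d + a ≤ d⁺ + a := by gcongr; exact le_posPart d
      _ = d⁺ ⊔ a := by rw [← inf_add_sup, hda, zero_add]
      _ ≤ x⁺ := sup_le (posPart_mono (hx.1 hd)) inf_le_left
  have hxa : x⁺ ≤ x⁺ - a := sup_le (hx.2 hd) (sub_nonneg.mpr inf_le_left)
  rw [mem_disjointComplement, abs_of_nonneg (posPart_nonneg x)]
  exact le_antisymm ((le_sub_self_iff _).mp hxa) ha

theorem isBand_disjointComplement (v : E) : IsBand (disjointComplement v) where
  solid := isSolid_disjointComplement v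
  sup_mem D x hD hx := by
    rcases D.eq_empty_or_nonempty with rfl | ⟨d, hd⟩
    · have hbot : IsBot x := isLUB_empty_iff.mp hx
      have hx0 : x = 0 := (hbot 0).antisymm ((le_add_iff_nonneg_left x).mp (hbot (x + x)))
      exact hx0 ▸ Submodule.zero_mem _
    · have hneg : x⁻ ∈ disjointComplement v := isSolid_disjointComplement v (hD hd) <| by
        rw [abs_of_nonneg (negPart_nonneg x)]
        exact sup_le ((neg_le_neg (hx.1 hd)).trans (neg_le_abs d)) (abs_nonneg d)
      rw [← posPart_sub_negPart x]
      exact sub_mem (posPart_mem_disjointComplement_of_isLUB hD hx) hneg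

theorem mem_disjointComplement_of_forall_nsmul [IsArchimedeanOrderedGroup E] {v x d : E}
    (hx : 0 ≤ x) (hd : 0 ≤ d) (h : ∀ n : ℕ, (x - n • d)⁻ ∈ disjointComplement v) :
    d ∈ disjointComplement v := by
  set e := d ⊓ |v|
  have he : 0 ≤ e := le_inf hd (abs_nonneg v)
  have hex : ∀ n : ℕ, n • e ≤ x := fun n => by
    have hle : (n • e - x)⁺ ≤ (x - n • d)⁻ := by
      rw [← posPart_neg, neg_sub]
      exact posPart_mono (sub_le_sub_right (nsmul_le_nsmul_right inf_le_left n) x)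
    have hne : (n • e - x)⁺ ∈ disjointComplement (n • e) := by
      refine mem_disjointComplement_comm.mp (nsmul_mem (mem_disjointComplement_comm.mp ?_) n)
      have hv := mem_disjointComplement_of_le (posPart_nonneg _) hle (h n)
      exact mem_disjointComplement_comm.mp <|
        isSolid_disjointComplement _ (mem_disjointComplement_comm.mp hv)
          ((abs_of_nonneg he).trans_le inf_le_right)
    exact sub_nonpos.mp <| posPart_eq_zero.mp <| eq_zero_of_mem_disjointComplement_of_le
      (posPart_nonneg _) (sup_le (sub_le_self _ hx) (nsmul_nonneg he n)) hne
  rw [mem_disjointComplement, abs_of_nonneg hd]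
  exact le_antisymm (IsArchimedeanOrderedGroup.nonpos_of_forall_nsmul_le e x hex) he

end DisjointComplement

section Orthomorphism

variable {E : Type u} [AddCommGroup E] [Lattice E] [IsOrderedAddMonoid E] [Module ℝ E]
  {T : E →ₗ[ℝ] E}

theorem isOrderBoundedOperator_iff :
    IsOrderBoundedOperator T ↔ ∀ s : E, ∃ M : E, ∀ r ∈ Icc 0 s, |T r| ≤ M := by
  refine ⟨fun hT s => ?_, fun h S ⟨l, hl⟩ ⟨u, hu⟩ => ?_⟩
  · obtain ⟨⟨a, ha⟩, b, hb⟩ := hT (Icc 0 s) bddBelow_Icc bddAbove_Icc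
    refine ⟨b ⊔ -a, fun r hr => sup_le_sup (hb (mem_image_of_mem T hr)) ?_⟩
    exact neg_le_neg (ha (mem_image_of_mem T hr))
  · obtain ⟨M, hM⟩ := h (u - l)
    have hdist : ∀ r ∈ S, |T r - T l| ≤ M := fun r hr => by
      rw [← map_sub]
      exact hM _ ⟨sub_nonneg.mpr (hl hr), sub_le_sub_right (hu hr) l⟩
    refine ⟨⟨T l - M, forall_mem_image.mpr fun r hr => ?_⟩,
      ⟨T l + M, forall_mem_image.mpr fun r hr => ?_⟩⟩
    · rw [sub_le_comm, ← neg_sub]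
      exact (neg_le_abs _).trans (hdist r hr)
    · exact sub_le_iff_le_add'.mp ((le_abs_self _).trans (hdist r hr))

theorem IsOrthomorphism.neg (hT : IsOrthomorphism T) : IsOrthomorphism (-T) where
  orderBounded := by
    have hbdd := isOrderBoundedOperator_iff.mp hT.orderBounded
    simpa only [isOrderBoundedOperator_iff, LinearMap.neg_apply, abs_neg] using hbdd
  bandPreserving B hB x hx := neg_mem (hT.bandPreserving B hB x hx)

theorem sub_le_negPart_add_abs_map_add_abs_map {x d w M : E} (hd : 0 ≤ d) (hwx : w ≤ (T x)⁺)
    (hM : ∀ r ∈ Icc 0 d, |T r| ≤ M) (n : ℕ) :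
    w - M ≤ (T x)⁻ + n • (T d)⁺ + |T (x - n • d)⁻| + |T (x - (n + 1) • d)⁺| := by
  set a := x - n • d
  have ha : x - (n + 1) • d = a - d := by rw [succ_nsmul, ← sub_sub]
  have hstep : T a⁺ - T (a - d)⁺ ≤ M := by
    rw [← map_sub]
    exact (le_abs_self _).trans (hM _ (posPart_sub_posPart_sub_mem_Icc a hd))
  have hTa : T x = T a⁺ - T a⁻ + n • T d := by
    rw [← map_sub, posPart_sub_negPart, ← map_nsmul, ← map_add, sub_add_cancel]
  rw [ha]
  calc w - M ≤ (T x)⁺ - (T a⁺ - T (a - d)⁺) := sub_le_sub hwx hstep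
    _ = (T x)⁻ + n • T d + -T a⁻ + T (a - d)⁺ := by
      rw [← sub_add_cancel (T x)⁺ (T x)⁻, posPart_sub_negPart]
      nth_rewrite 1 [hTa]
      abel
    _ ≤ _ := by
      gcongr
      · exact le_posPart _
      · exact neg_le_abs _
      · exact le_abs_self _

variable [IsOrderedModule ℝ E]

theorem IsOrthomorphism.sub_smul_id (hT : IsOrthomorphism T) (c : ℝ) :
    IsOrthomorphism (T - c • LinearMap.id) where
  orderBounded := isOrderBoundedOperator_iff.mpr fun s => by
    obtain ⟨M, hM⟩ := isOrderBoundedOperator_iff.mp hT.orderBounded s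
    refine ⟨M + |c| • s, fun r hr => ?_⟩
    calc |T r - c • r| ≤ |T r| + |c • r| := by
          simpa [sub_eq_add_neg] using abs_add_le (T r) (-(c • r))
      _ ≤ M + |c| • |r| := add_le_add (hM r hr) (abs_smul_le_smul_abs c r)
      _ ≤ M + |c| • s := by
          rw [abs_of_nonneg hr.1]
          gcongr
          exact hr.2
  bandPreserving B hB x hx := sub_mem (hT.bandPreserving B hB x hx) (B.smul_mem c hx)

theorem IsOrderBoundedOperator.exists_abs_le_smul (hT : IsOrderBoundedOperator T) (s : E) :
    ∃ M : E, ∀ ε : ℝ, 0 < ε → ∀ r ∈ Icc 0 (ε • s), |T r| ≤ ε • M := by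
  obtain ⟨M, hM⟩ := isOrderBoundedOperator_iff.mp hT s
  refine ⟨M, fun ε hε r hr => ?_⟩
  have hmem : ε⁻¹ • r ∈ Icc 0 s :=
    ⟨smul_nonneg (inv_nonneg.mpr hε.le) hr.1, (inv_smul_le_iff_of_pos hε).mpr hr.2⟩
  calc |T r| = |ε • T (ε⁻¹ • r)| := by rw [← map_smul, smul_inv_smul₀ hε.ne']
    _ ≤ ε • |T (ε⁻¹ • r)| := by simpa [abs_of_pos hε] using abs_smul_le_smul_abs ε (T (ε⁻¹ • r))
    _ ≤ ε • M := smul_le_smul_of_nonneg_left (hM _ hmem) hε.le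

theorem IsOrthomorphism.map_mem_disjointComplement (hT : IsOrthomorphism T) {a v : E}
    (h : a ∈ disjointComplement v) : T a ∈ disjointComplement v :=
  hT.bandPreserving _ (isBand_disjointComplement v) a h

theorem IsOrthomorphism.negPart_sub_nsmul_mem_disjointComplement (hT : IsOrthomorphism T)
    {x d w M : E} (hx : 0 ≤ x) (hd : 0 ≤ d) (hw : 0 ≤ w) (hwx : w ≤ (T x)⁺)
    (hwd : (T d)⁺ ∈ disjointComplement w) (hM : ∀ r ∈ Icc 0 d, |T r| ≤ M) (n : ℕ) :
    (x - n • d)⁻ ∈ disjointComplement (w - M)⁺ := by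
  set v := (w - M)⁺
  have hM0 : 0 ≤ M := by simpa using hM 0 ⟨le_rfl, hd⟩
  have hvw : v ≤ w := sup_le (sub_le_self w hM0) hw
  induction n with
  | zero => simp [negPart_eq_zero.mpr hx]
  | succ n ih =>
    set u := (x - (n + 1) • d)⁻ ⊓ v
    have hu : 0 ≤ u := le_inf (negPart_nonneg _) (posPart_nonneg _)
    have hTx : (T x)⁻ ∈ disjointComplement u :=
      disjointComplement_anti hu (inf_le_right.trans (hvw.trans hwx))
        (mem_disjointComplement_comm.mp (posPart_mem_disjointComplement_negPart (T x)))
    have hTd : n • (T d)⁺ ∈ disjointComplement u :=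
      nsmul_mem (disjointComplement_anti hu (inf_le_right.trans hvw) hwd) n
    have hbelow : |T (x - n • d)⁻| ∈ disjointComplement u :=
      isSolid_disjointComplement u
        (hT.map_mem_disjointComplement (disjointComplement_anti hu inf_le_right ih))
        (abs_abs _).le
    have habove : |T (x - (n + 1) • d)⁺| ∈ disjointComplement u :=
      isSolid_disjointComplement u
        (hT.map_mem_disjointComplement (disjointComplement_anti hu inf_le_left
          (posPart_mem_disjointComplement_negPart _)))
        (abs_abs _).le
    have hvu : v ∈ disjointComplement u := by
      refine mem_disjointComplement_of_le (posPart_nonneg _) (sup_le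
        (sub_le_negPart_add_abs_map_add_abs_map hd hwx hM n) ?_)
        (add_mem (add_mem (add_mem hTx hTd) hbelow) habove)
      have := negPart_nonneg (T x)
      have := posPart_nonneg (T d)
      positivity
    have hu0 : u = 0 := eq_zero_of_mem_disjointComplement_of_le hu inf_le_right
      (mem_disjointComplement_comm.mp hvu)
    rwa [mem_disjointComplement, abs_of_nonneg (negPart_nonneg _),
      abs_of_nonneg (posPart_nonneg _)]

variable [IsArchimedeanOrderedGroup E]

theorem IsOrthomorphism.mem_disjointComplement_posPart_sub (hT : IsOrthomorphism T)
    {x d w M : E} (hx : 0 ≤ x) (hd : 0 ≤ d) (hw : 0 ≤ w) (hwx : w ≤ (T x)⁺)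
    (hwd : (T d)⁺ ∈ disjointComplement w) (hM : ∀ r ∈ Icc 0 d, |T r| ≤ M) :
    d ∈ disjointComplement (w - M)⁺ :=
  mem_disjointComplement_of_forall_nsmul hx hd
    (hT.negPart_sub_nsmul_mem_disjointComplement hx hd hw hwx hwd hM)

theorem IsOrthomorphism.posPart_map_mem_disjointComplement_negPart_map (hT : IsOrthomorphism T)
    {x s : E} (hx : 0 ≤ x) (hs : 0 ≤ s) : (T x)⁺ ∈ disjointComplement (T s)⁻ := by
  set w := (T x)⁺ ⊓ (T s)⁻
  have hw : 0 ≤ w := le_inf (posPart_nonneg _) (negPart_nonneg _)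
  have hws : (T s)⁺ ∈ disjointComplement w :=
    disjointComplement_anti hw inf_le_right (posPart_mem_disjointComplement_negPart (T s))
  obtain ⟨M, hM⟩ := hT.orderBounded.exists_abs_le_smul s
  have hwM : ∀ n : ℕ, w ≤ ((n : ℝ) + 1)⁻¹ • M := fun n => by
    set ε : ℝ := ((n : ℝ) + 1)⁻¹
    have hε : 0 < ε := inv_pos.mpr n.cast_add_one_pos
    have hεs : 0 ≤ ε • s := smul_nonneg hε.le hs
    have hεM : 0 ≤ ε • M := by simpa using hM ε hε 0 ⟨le_rfl, hεs⟩
    have hTεs : (T (ε • s))⁺ ≤ ε • (T s)⁺ := by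
      rw [map_smul]
      exact sup_le (smul_le_smul_of_nonneg_left (le_posPart _) hε.le)
        (smul_nonneg hε.le (posPart_nonneg _))
    have hmem : ε • s ∈ disjointComplement (w - ε • M)⁺ :=
      hT.mem_disjointComplement_posPart_sub hx hεs hw inf_le_left
        (mem_disjointComplement_of_le (posPart_nonneg _) hTεs (Submodule.smul_mem _ ε hws))
        (hM ε hε)
    have hTs : T s ∈ disjointComplement (w - ε • M)⁺ :=
      hT.map_mem_disjointComplement ((Submodule.smul_mem_iff _ hε.ne').mp hmem)
    have hneg : (T s)⁻ ∈ disjointComplement (w - ε • M)⁺ :=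
      isSolid_disjointComplement _ hTs
        ((abs_of_nonneg (negPart_nonneg _)).trans_le (sup_le (neg_le_abs _) (abs_nonneg _)))
    rw [← sub_nonpos, ← posPart_eq_zero]
    exact eq_zero_of_mem_disjointComplement_of_le (posPart_nonneg _)
      (sup_le ((sub_le_self w hεM).trans inf_le_right) (negPart_nonneg _))
      (mem_disjointComplement_comm.mp hneg)
  rw [mem_disjointComplement, abs_of_nonneg (posPart_nonneg _), abs_of_nonneg (negPart_nonneg _)]
  exact le_antisymm (nonpos_of_forall_le_inv_smul hwM) hw

theorem IsOrthomorphism.posPart_abs_map_sub_smul_mem_disjointComplement (hT : IsOrthomorphism T)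
    (c : ℝ) {x s : E} (hx : 0 ≤ x) (hs : 0 ≤ s) :
    (|T x| - c • x)⁺ ∈ disjointComplement (c • s - |T s|)⁺ := by
  have hsigned : ∀ {S : E →ₗ[ℝ] E}, IsOrthomorphism S → S s ≤ |T s| →
      (S x - c • x)⁺ ∈ disjointComplement (c • s - |T s|)⁺ := fun {S} hS hle => by
    refine disjointComplement_anti (posPart_nonneg _) ?_
      ((hS.sub_smul_id c).posPart_map_mem_disjointComplement_negPart_map hx hs)
    rw [← posPart_neg]
    simpa using posPart_mono (sub_le_sub_left hle (c • s))
  refine mem_disjointComplement_of_le (posPart_nonneg _) (sup_le ?_ ?_)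
    (add_mem (hsigned hT (le_abs_self _)) (hsigned hT.neg (neg_le_abs _)))
  · rw [sub_le_iff_le_add]
    exact abs_le'.mpr
      ⟨sub_le_iff_le_add.mp ((le_posPart _).trans (le_add_of_nonneg_right (posPart_nonneg _))),
        sub_le_iff_le_add.mp ((le_posPart _).trans (le_add_of_nonneg_left (posPart_nonneg _)))⟩
  · exact add_nonneg (posPart_nonneg _) (posPart_nonneg _)

theorem IsOrthomorphism.posPart_abs_map_sub_smul_abs_mem_disjointComplement
    (hT : IsOrthomorphism T) (c : ℝ) (x : E) {s : E} (hs : 0 ≤ s) :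
    (|T x| - c • |x|)⁺ ∈ disjointComplement (c • s - |T s|)⁺ := by
  refine mem_disjointComplement_of_le (posPart_nonneg _) ?_ (add_mem
    (hT.posPart_abs_map_sub_smul_mem_disjointComplement c (posPart_nonneg x) hs)
    (hT.posPart_abs_map_sub_smul_mem_disjointComplement c (negPart_nonneg x) hs))
  calc (|T x| - c • |x|)⁺
    _ ≤ (|T x⁺| + |T x⁻| - c • |x|)⁺ := by
      refine posPart_mono (sub_le_sub_right ?_ _)
      nth_rewrite 1 [← posPart_sub_negPart x]
      simpa [sub_eq_add_neg] using abs_add_le (T x⁺) (-T x⁻)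
    _ = (|T x⁺| - c • x⁺ + (|T x⁻| - c • x⁻))⁺ := by
      rw [← posPart_add_negPart x, smul_add, add_sub_add_comm]
    _ ≤ _ := posPart_add_le _ _

theorem IsOrthomorphism.posPart_abs_map_sub_smul_abs_inf_le (hT : IsOrthomorphism T) {c : ℝ}
    (hc : 0 < c) (x : E) {s : E} (hs : 0 ≤ s) : (|T x| - c • |x|)⁺ ⊓ s ≤ c⁻¹ • |T s| := by
  have hmem := hT.posPart_abs_map_sub_smul_abs_mem_disjointComplement c x
    (smul_nonneg (inv_nonneg.mpr hc.le) hs)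
  rw [smul_inv_smul₀ hc.ne', mem_disjointComplement, abs_of_nonneg (posPart_nonneg _),
    abs_of_nonneg (posPart_nonneg _)] at hmem
  calc (|T x| - c • |x|)⁺ ⊓ s ≤ |T (c⁻¹ • s)| := le_of_inf_posPart_sub_eq_zero (abs_nonneg _) hmem
    _ ≤ c⁻¹ • |T s| := by
      simpa [abs_of_pos hc] using abs_smul_le_smul_abs c⁻¹ (T s)

theorem IsOrthomorphism.abs_map_inf_le (hT : IsOrthomorphism T) {c : ℝ} (hc : 0 < c) (x : E)
    {s : E} (hs : 0 ≤ s) : |T x| ⊓ s ≤ c • |x| + c⁻¹ • |T s| :=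
  calc |T x| ⊓ s ≤ (c • |x| + (|T x| - c • |x|)⁺) ⊓ s :=
        inf_le_inf_right s (sub_le_iff_le_add'.mp (le_posPart _))
    _ ≤ c • |x| + (|T x| - c • |x|)⁺ ⊓ s := add_inf_le_add_inf (smul_nonneg hc.le (abs_nonneg x))
    _ ≤ c • |x| + c⁻¹ • |T s| := by
      gcongr
      exact hT.posPart_abs_map_sub_smul_abs_inf_le hc x hs

end Orthomorphism

section Continuity

open Topology

variable {E : Type u} [AddCommGroup E] [Lattice E] [Module ℝ E] {τ : TopologicalSpace E}

theorem IsUoLebesgueTopology.tendsto_atTop_nat (hτ : IsUoLebesgueTopology τ) {z : ℕ → E}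
    (hz : UnboundedOrderConverges z 0) : Tendsto z atTop (@nhds E τ 0) := by
  have hdir : IsDirectedOrder (ULift.{u} ℕ) :=
    ⟨fun m n => ⟨⟨m.down ⊔ n.down⟩, le_sup_left, le_sup_right⟩⟩
  have huo : UnboundedOrderConverges (fun n : ULift.{u} ℕ => z n.down) 0 := fun s hs => by
    obtain ⟨B, hB, hBdir, hBne, y, hanti, hglb, hzy⟩ := hz s hs
    refine ⟨B, hB, hBdir, hBne, y, hanti, hglb, fun b => ?_⟩
    obtain ⟨n, hn⟩ := hzy b
    exact ⟨⟨n⟩, fun m hm => hn m.down hm⟩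
  refine (hτ.tendsto_of_uo _ _ huo).comp (x := atTop) (f := ULift.up) ?_
  exact tendsto_atTop_atTop.mpr fun n => ⟨n.down, fun m hm => hm⟩

variable [IsOrderedAddMonoid E]

theorem IsLocallySolidLinearTopology.tendsto_zero_of_abs_le
    (hτ : IsLocallySolidLinearTopology τ) {ι : Type v} {l : Filter ι} {x f : ι → E}
    (hx : Tendsto x l (@nhds E τ 0))
    (h : ∀ V ∈ @nhds E τ 0, ∃ (c : ℝ) (b : ι → E), (∀ i, b i ∈ V) ∧
      ∀ i, |f i| ≤ c • |x i| + b i) : Tendsto f l (@nhds E τ 0) := by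
  have := hτ.topologicalAddGroup
  have := hτ.continuousSMul
  have habs : Tendsto (fun i => |x i|) l (nhds 0) :=
    hτ.squeeze (.of_forall fun i => (abs_abs (x i)).le) hx
  intro U hU
  obtain ⟨W, hW, hWsolid, hWU⟩ := hτ.exists_solid U hU
  obtain ⟨V, hV, hVW⟩ := exists_nhds_zero_half hW
  obtain ⟨c, b, hb, hf⟩ := h V hV
  have hcx : Tendsto (fun i => c • |x i|) l (nhds 0) := by simpa using habs.const_smul c
  change ∀ᶠ i in l, f i ∈ U
  filter_upwards [hcx hV] with i hi
  exact hWU (hWsolid (hVW _ hi _ (hb i)) ((hf i).trans (le_abs_self _)))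

variable [IsOrderedModule ℝ E] [IsArchimedeanOrderedGroup E] {T : E →ₗ[ℝ] E}

theorem IsOrthomorphism.exists_posPart_abs_map_sub_smul_abs_mem (hT : IsOrthomorphism T)
    (hτ : IsUoLebesgueTopology τ) {V : Set E} (hV : V ∈ @nhds E τ 0) :
    ∃ c : ℝ, ∀ x, (|T x| - c • |x|)⁺ ∈ V := by
  by_contra! hout
  choose y hy using fun n : ℕ => hout (n + 1)
  have huo : UnboundedOrderConverges (fun n : ℕ => (|T (y n)| - ((n : ℝ) + 1) • |y n|)⁺) 0 := by
    refine unboundedOrderConverges_zero_of_antitone fun s hs =>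
      ⟨fun n => ((n : ℝ) + 1)⁻¹ • |T s|, fun m n hmn => ?_,
        isGLB_range_inv_smul (abs_nonneg _), fun n => ?_⟩
    · have := abs_nonneg (T s)
      dsimp only
      gcongr
    · rw [abs_of_nonneg (posPart_nonneg _)]
      exact hT.posPart_abs_map_sub_smul_abs_inf_le n.cast_add_one_pos (y n) hs
  obtain ⟨n, hn⟩ := ((hτ.tendsto_atTop_nat huo).eventually hV).exists
  exact hy n hn

theorem IsOrthomorphism.continuous_of_isUoLebesgueTopology (hT : IsOrthomorphism T)
    (hτ : IsUoLebesgueTopology τ) : Continuous[τ, τ] T := by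
  have := hτ.locallySolid.topologicalAddGroup
  refine continuous_of_tendsto_nhds_zero T ?_
  refine hτ.locallySolid.tendsto_zero_of_abs_le tendsto_id fun V hV => ?_
  obtain ⟨c, hc⟩ := hT.exists_posPart_abs_map_sub_smul_abs_mem hτ hV
  exact ⟨c, fun x => (|T x| - c • |x|)⁺, hc, fun x => sub_le_iff_le_add'.mp (le_posPart _)⟩

theorem IsOrthomorphism.continuous_unboundedTopology (hT : IsOrthomorphism T)
    (hτ : IsLocallySolidLinearTopology τ) : Continuous[τ, unboundedTopology τ] T := by
  have := hτ.topologicalAddGroup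
  have := hτ.continuousSMul
  have hgroup := (isLocallySolidLinearTopology_unboundedTopology hτ).topologicalAddGroup
  refine @continuous_of_tendsto_nhds_zero E τ _ _ E _ _ (unboundedTopology τ) _ _ _ T ?_
  refine (tendsto_unboundedTopology_zero hτ).mpr fun s =>
    hτ.tendsto_zero_of_abs_le tendsto_id fun V hV => ?_
  have hsmall : Tendsto (fun c : ℝ => c⁻¹ • |T (|s|)|) atTop (nhds 0) := by
    simpa using (tendsto_inv_atTop_zero (𝕜 := ℝ)).smul_const |T (|s|)|
  obtain ⟨c, hcV, hc⟩ := ((hsmall.eventually hV).and (eventually_gt_atTop 0)).exists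
  refine ⟨c, fun _ => c⁻¹ • |T (|s|)|, fun _ => hcV, fun x => ?_⟩
  rw [abs_of_nonneg (le_inf (abs_nonneg _) (abs_nonneg _))]
  exact hT.abs_map_inf_le hc x (abs_nonneg s)

end Continuity

open Topology in
theorem mainTheorem9_general {E : Type u} [AddCommGroup E] [Lattice E] [IsOrderedAddMonoid E]
    [IsArchimedeanOrderedGroup E] [Module ℝ E] [IsOrderedModule ℝ E]
    (T : E →ₗ[ℝ] E) (hT : IsOrthomorphism T) :
    (∀ τ : TopologicalSpace E, IsUoLebesgueTopology τ → Continuous[τ, τ] T) ∧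
    (∀ τ : TopologicalSpace E, IsLocallySolidLinearTopology τ →
      Continuous[τ, unboundedTopology τ] T) :=
  ⟨fun _ => hT.continuous_of_isUoLebesgueTopology, fun _ => hT.continuous_unboundedTopology⟩

/-- Orthomorphisms of a Dedekind complete vector lattice `E` preserve convergence to zero in a
Hausdorff uo-Lebesgue topology, and turn convergence to zero in a locally solid linear topology
into convergence to zero in the unbounded topology generated by it. -/
theorem mainTheorem9 {E : Type u} [AddCommGroup E] [ConditionallyCompleteLattice E]
    [IsOrderedAddMonoid E] [Module ℝ E] [IsOrderedModule ℝ E]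
    (T : E →ₗ[ℝ] E) (hT : IsOrthomorphism T)
    {ι : Type v} [Preorder ι] [IsDirectedOrder ι] [Nonempty ι] (x : ι → E) :
    (∀ τ : TopologicalSpace E, IsUoLebesgueTopology τ → @T2Space E τ →
      Tendsto x atTop (@nhds E τ 0) →
        Tendsto (fun i => T (x i)) atTop (@nhds E τ 0)) ∧
    (∀ τ : TopologicalSpace E, IsLocallySolidLinearTopology τ →
      Tendsto x atTop (@nhds E τ 0) →
        Tendsto (fun i => T (x i)) atTop (@nhds E (unboundedTopology τ) 0)) := by
  obtain ⟨huo, hunbounded⟩ := mainTheorem9_general T hT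
  refine ⟨fun τ hτ _ hx => ?_, fun τ hτ hx => ?_⟩
  · exact (@Continuous.tendsto' E E τ τ T (huo τ hτ) 0 0 (map_zero T)).comp hx
  · exact (@Continuous.tendsto' E E τ (unboundedTopology τ) T (hunbounded τ hτ) 0 0
      (map_zero T)).comp hx
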